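/- Let $E$ be a finite-dimensional $\mathbb{Q}$-vector space with a positive definite symmetric bilinear form $(\,,\,)$, and put $e^\vee=\frac{2}{(e,e)}e$ for $0\neq e\in E$. Let $\Phi\subseteq E$ be an irreducible reduced crystallographic root system spanning $E$, with simple roots $\{\alpha_i\mid i\in I\}$ and Weyl group $W\subseteq \mathrm{GL}(E)$; let $s_i\in W$ be the reflection in $\alpha_i$. A weight $\lambda$ (a vector with $(\lambda,\alpha_i^\vee)\in\mathbb{Z}$ for all $i\in I$) is called minuscule if $\lambda\neq 0$, $(\lambda,\alpha_i^\vee)\geq 0$ for all $i\in I$, and $(\lambda,\alpha^\vee)\in\{0,\pm1\}$ for all $\alpha\in\Phi$. Let $\Psi\subseteq E$ be a non-empty union of $W$-orbits of minuscule weights. Let $R\neq 0$ be a commutative ring with $1$, and let $\bar M$ be a free $R$-module with a basis $\{\bar z_\mu\mid\mu\in\Psi\}$. For $i\in I$ let $\bar e_i,\bar f_i\colon\bar M\to\bar M$ be the $R$-linear maps such that $\bar e_i(\bar z_\mu)=\bar z_{\mu+\alpha_i}$ if $(\mu,\alpha_i^\vee)=-1$ and $\bar e_i(\bar z_\mu)=0$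 otherwise, and $\bar f_i(\bar z_\mu)=\bar z_{\mu-\alpha_i}$ if $(\mu,\alpha_i^\vee)=1$ and $\bar f_i(\bar z_\mu)=0$ otherwise. Then $\bar e_i^2=\bar f_i^2=0$, so that $x_i(t)=\mathrm{id}_{\bar M}+t\bar e_i$ and $y_i(t)=\mathrm{id}_{\bar M}+t\bar f_i$ lie in $\mathrm{GL}(\bar M)$ for all $t\in R$. For $t\in R^\times$ put $\bar n_i(t)=x_i(t)\,y_i(-t^{-1})\,x_i(t)$ and $h_i(t)=\bar n_i(t)\,\bar n_i(-1)$, and write $\bar n_i=\bar n_i(1)$. Let $N=\langle \bar n_i(t)\mid i\in I,\ t\in R^\times\rangle$ and $H=\langle h_i(t)\mid i\in I,\ t\in R^\times\rangle\subseteq N$. Then $H$ is a normal subgroup of $N$, and there is a unique group isomorphism $W\to N/H$ such that $s_i\mapsto \bar n_iH$ for all $i\in I$. -/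

import Mathlib

noncomputable section

open Module

namespace MinusculeChevalley

variable {ι E E' : Type*} [AddCommGroup E] [Module ℚ E] [AddCommGroup E'] [Module ℚ E']
  {P : RootPairing ι ℚ E E'}

/-- `(lam, α^∨)` is written `P.coroot' a lam` when `α` is the root with index `a`.
The weight lattice: all vectors whose pairings with the simple coroots are integers, i.e. the
`ℤ`-span of the basis dual to the simple coroots. -/
def weightLattice (b : P.Base) : AddSubgroup E where
  carrier := {lam | ∀ i : b.support, ∃ k : ℤ, P.coroot' i lam = k}
  zero_mem' := fun i => ⟨0, by simp⟩
  add_mem' := by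
    intro x y hx hy i
    obtain ⟨k, hk⟩ := hx i
    obtain ⟨l, hl⟩ := hy i
    exact ⟨k + l, by rw [map_add, hk, hl]; push_cast; rfl⟩
  neg_mem' := by
    intro x hx i
    obtain ⟨k, hk⟩ := hx i
    exact ⟨-k, by rw [map_neg, hk]; push_cast; rfl⟩

/-- A minuscule weight: a nonzero dominant weight `lam` with `(lam, α^∨) ∈ {0, 1, -1}` for every
root `α`. -/
structure IsMinuscule (b : P.Base) (lam : E) : Prop where
  mem_weightLattice : lam ∈ weightLattice b
  ne_zero : lam ≠ 0
  dominant : ∀ i : b.support, 0 ≤ P.coroot' i lam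
  coroot_apply : ∀ a : ι, P.coroot' a lam = 0 ∨ P.coroot' a lam = 1 ∨ P.coroot' a lam = -1

/-- `Psi` is a non-empty union of Weyl group orbits of minuscule weights. -/
structure IsMinusculeUnion (b : P.Base) (Psi : Set E) : Prop where
  nonempty : Psi.Nonempty
  eq_union : ∃ S : Set E, (∀ lam ∈ S, IsMinuscule b lam) ∧
    Psi = ⋃ lam ∈ S, MulAction.orbit P.weylGroup lam

variable {b : P.Base} {Psi : Set E}

theorem IsMinusculeUnion.reflection_mem (hPsi : IsMinusculeUnion b Psi) (a : ι) {mu : E}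
    (hmu : mu ∈ Psi) : mu - P.coroot' a mu • P.root a ∈ Psi := by
  obtain ⟨S, -, rfl⟩ := hPsi.eq_union
  simp only [Set.mem_iUnion] at hmu ⊢
  obtain ⟨lam, hlam, h⟩ := hmu
  refine ⟨lam, hlam, ?_⟩
  have h2 := MulAction.mem_orbit_of_mem_orbit (RootPairing.weylGroup.ofIdx P a) h
  have h3 : RootPairing.weylGroup.ofIdx P a • mu = mu - P.coroot' a mu • P.root a := by
    rw [RootPairing.weylGroup.ofIdx_smul]
    exact P.reflection_apply a mu
  rwa [h3] at h2

/-- If `(mu, α^∨) = -1`, then `mu + α` lies again in `Psi`. -/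
theorem IsMinusculeUnion.add_root_mem (hPsi : IsMinusculeUnion b Psi) (a : ι) {mu : E}
    (hmu : mu ∈ Psi) (h : P.coroot' a mu = -1) : mu + P.root a ∈ Psi := by
  have := hPsi.reflection_mem a hmu
  rwa [h, neg_one_smul, sub_neg_eq_add] at this

/-- If `(mu, α^∨) = 1`, then `mu - α` lies again in `Psi`. -/
theorem IsMinusculeUnion.sub_root_mem (hPsi : IsMinusculeUnion b Psi) (a : ι) {mu : E}
    (hmu : mu ∈ Psi) (h : P.coroot' a mu = 1) : mu - P.root a ∈ Psi := by
  have := hPsi.reflection_mem a hmu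
  rwa [h, one_smul] at this

variable {R V : Type*} [CommRing R] [AddCommGroup V] [Module R V]

/-- The map `e_i`: it sends `z_mu` to `z_{mu + α_i}` if `(mu, α_i^∨) = -1`, and to `0` otherwise. -/
def e (hPsi : IsMinusculeUnion b Psi) (z : Basis Psi R V) (i : b.support) : V →ₗ[R] V :=
  z.constr R fun mu =>
    if h : P.coroot' i mu = -1 then
      z ⟨(mu : E) + P.root i, hPsi.add_root_mem i mu.2 h⟩
    else 0

/-- The map `f_i`: it sends `z_mu` to `z_{mu - α_i}` if `(mu, α_i^∨) = 1`, and to `0` otherwise. -/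
def f (hPsi : IsMinusculeUnion b Psi) (z : Basis Psi R V) (i : b.support) : V →ₗ[R] V :=
  z.constr R fun mu =>
    if h : P.coroot' i mu = 1 then
      z ⟨(mu : E) - P.root i, hPsi.sub_root_mem i mu.2 h⟩
    else 0

variable (hPsi : IsMinusculeUnion b Psi) (z : Basis Psi R V)

theorem e_mul_e (i : b.support) : e hPsi z i * e hPsi z i = 0 := by
  refine z.ext fun mu => ?_
  rw [Module.End.mul_apply]
  by_cases h : P.coroot' i mu = -1
  · have h2 : ¬ P.coroot' i ((mu : E) + P.root i) = -1 := by
      rw [map_add, h, P.root_coroot'_eq_pairing, P.pairing_same]; norm_num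
    simp only [e, Basis.constr_basis, dif_pos h, dif_neg h2, LinearMap.zero_apply]
  · simp only [e, Basis.constr_basis, dif_neg h, map_zero, LinearMap.zero_apply]

theorem f_mul_f (i : b.support) : f hPsi z i * f hPsi z i = 0 := by
  refine z.ext fun mu => ?_
  rw [Module.End.mul_apply]
  by_cases h : P.coroot' i mu = 1
  · have h2 : ¬ P.coroot' i ((mu : E) - P.root i) = 1 := by
      rw [map_sub, h, P.root_coroot'_eq_pairing, P.pairing_same]; norm_num
    simp only [f, Basis.constr_basis, dif_pos h, dif_neg h2, LinearMap.zero_apply]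
  · simp only [f, Basis.constr_basis, dif_neg h, map_zero, LinearMap.zero_apply]

/-- The invertible map `id + a` for an endomorphism `a` with `a² = 0`. -/
def oneAdd (a : V →ₗ[R] V) (ha : a * a = 0) : LinearMap.GeneralLinearGroup R V where
  val := 1 + a
  inv := 1 - a
  val_inv := by rw [mul_sub, mul_one, add_mul, one_mul, ha]; abel
  inv_val := by rw [sub_mul, one_mul, mul_add, mul_one, ha]; abel

/-- `x_i(t) = id + t e_i`. -/
def x (i : b.support) (t : R) : LinearMap.GeneralLinearGroup R V :=
  oneAdd (t • e hPsi z i) (by rw [smul_mul_smul_comm, e_mul_e, smul_zero])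

/-- `y_i(t) = id + t f_i`. -/
def y (i : b.support) (t : R) : LinearMap.GeneralLinearGroup R V :=
  oneAdd (t • f hPsi z i) (by rw [smul_mul_smul_comm, f_mul_f, smul_zero])

/-- The Chevalley group `G`, generated by all `x_i(t)` and `y_i(t)`. -/
def G : Subgroup (LinearMap.GeneralLinearGroup R V) :=
  Subgroup.closure {g | ∃ (i : b.support) (t : R), g = x hPsi z i t ∨ g = y hPsi z i t}

/-- `n_i(t) = x_i(t) y_i(-t⁻¹) x_i(t)` for a unit `t`; the element `n_i` is `n_i(1)`. -/
def n (i : b.support) (t : Rˣ) : LinearMap.GeneralLinearGroup R V :=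
  x hPsi z i (t : R) * y hPsi z i (-((t⁻¹ : Rˣ) : R)) * x hPsi z i (t : R)

/-- `h_i(t) = n_i(t) n_i(-1)` for a unit `t`. -/
def h (i : b.support) (t : Rˣ) : LinearMap.GeneralLinearGroup R V :=
  n hPsi z i t * n hPsi z i (-1)

/-- The subgroup `H` generated by all `h_i(t)`. -/
def H : Subgroup (LinearMap.GeneralLinearGroup R V) :=
  Subgroup.closure {g | ∃ (i : b.support) (t : Rˣ), g = h hPsi z i t}

/-- The subgroup `N` generated by all `n_i(t)`. -/
def N : Subgroup (LinearMap.GeneralLinearGroup R V) :=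
  Subgroup.closure {g | ∃ (i : b.support) (t : Rˣ), g = n hPsi z i t}

theorem n_mem_N (i : b.support) (t : Rˣ) : n hPsi z i t ∈ N hPsi z :=
  Subgroup.subset_closure ⟨i, t, rfl⟩

theorem H_le_N : H hPsi z ≤ N hPsi z := by
  refine (Subgroup.closure_le _).2 ?_
  rintro _ ⟨i, t, rfl⟩
  exact mul_mem (n_mem_N hPsi z i t) (n_mem_N hPsi z i (-1))

theorem N_le_G : N hPsi z ≤ G hPsi z := by
  refine (Subgroup.closure_le _).2 ?_
  rintro _ ⟨i, t, rfl⟩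
  have hx : ∀ s : R, x hPsi z i s ∈ G hPsi z := fun s =>
    Subgroup.subset_closure ⟨i, s, Or.inl rfl⟩
  have hy : ∀ s : R, y hPsi z i s ∈ G hPsi z := fun s =>
    Subgroup.subset_closure ⟨i, s, Or.inr rfl⟩
  exact mul_mem (mul_mem (hx _) (hy _)) (hx _)

end MinusculeChevalley

end

/-! Each `n_i(t)` is monomial: it sends `z_mu` to a unit times `z_{s_i mu}`. Irreducibility makes
`Psi` span `E`, so the Weyl group acts faithfully on `Psi`, and reading off the permutation gives a
homomorphism `toWeylGroup` from `N` onto the Weyl group. `H` acts diagonally, hence lies in the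
kernel; the work is the converse inclusion.

Since `n_i(t) = h_i(t) n_i` and `N` normalizes `H`, every element of `N` is an element of `H` times
a word in the `n_i` (`exists_eq_mul_nWord`). So it suffices that a word whose image in the Weyl
group is `1` lies in `H` (`nWord_mem_H`). This goes by induction on the length: the exchange
argument writes such a word as `l₁ j l₂ k` with `weylWord l₂` taking `α_k` to `α_j`, and moving
`n_k` leftwards past the word of `l₂` turns it into `n_j(±1)`, which cancels `n_j` modulo `H`.

That move (`exists_nWord_mul_n`) needs one sign valid for all weights at once. The signs do not
depend on the ring, so they are compared over `ℚ`. There the span of iterated brackets of the `e_i`,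
of the `f_i`, and of the `[e_i, f_i]` is stable under conjugation by the `n_i`. For every operator
in it, all coefficients in the direction of a simple root `α_j` agree, because by height only `e_j`
contributes to them. Applied to the conjugate of an `e_i`, this gives the constant sign
(`wordSign_mul_wordSign`). -/

noncomputable section

open Module

namespace MinusculeChevalley

/-! ### Simple reflections, exchange, and the faithful action on `Psi` -/

section WeylGroup

variable {ι E E' : Type*} [AddCommGroup E] [Module ℚ E] [AddCommGroup E'] [Module ℚ E']
  {P : RootPairing ι ℚ E E'}

theorem weylGroup_ext {w w' : P.weylGroup} (hw : ∀ v : E, w • v = w' • v) : w = w' :=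
  Subtype.ext <| RootPairing.Equiv.weightHom_injective P <| LinearEquiv.ext hw

theorem root_smul (w : P.weylGroup) (a : ι) : P.root (w • a) = w • P.root a :=
  RootPairing.Equiv.root_indexEquiv_eq_smul P a w.1

theorem coroot'_smul (w : P.weylGroup) (a : ι) (v : E) :
    P.coroot' (w • a) (w • v) = P.coroot' a v := by
  have h1 := LinearMap.congr_fun (RootPairing.Hom.weight_coweight_transpose_apply P P
    (P.coroot (w • a)) w.1.toHom) v
  have h2 := RootPairing.Hom.coroot_coweightMap_apply P P (w • a) w.1.toHom
  rw [h2] at h1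
  have h3 : w.1.toHom.indexEquiv.symm (w • a) = a := w.1.toHom.indexEquiv.symm_apply_apply a
  rw [h3] at h1
  exact h1

theorem ofIdx_smul_eq_sub (a : ι) (v : E) :
    RootPairing.weylGroup.ofIdx P a • v = v - P.coroot' a v • P.root a := by
  rw [RootPairing.weylGroup.ofIdx_smul]
  exact P.reflection_apply a v

theorem ofIdx_smul_index (a c : ι) :
    RootPairing.weylGroup.ofIdx P a • c = P.reflectionPerm a c := by
  apply P.root.injective
  rw [root_smul, RootPairing.weylGroup.ofIdx_smul, RootPairing.root_reflectionPerm]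
  rfl

theorem ofIdx_mul_self (a : ι) :
    RootPairing.weylGroup.ofIdx P a * RootPairing.weylGroup.ofIdx P a = 1 := by
  refine weylGroup_ext fun v => ?_
  rw [mul_smul, one_smul]
  exact P.reflection_same a v

theorem mul_ofIdx (w : P.weylGroup) (a : ι) :
    w * RootPairing.weylGroup.ofIdx P a = RootPairing.weylGroup.ofIdx P (w • a) * w := by
  refine weylGroup_ext fun v => ?_
  rw [mul_smul, mul_smul, ofIdx_smul_eq_sub, ofIdx_smul_eq_sub, coroot'_smul, root_smul,
    smul_sub, smul_comm w]

/-- The element of the Weyl group represented by a word in the simple reflections. -/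
def weylWord {b : P.Base} (l : List b.support) : P.weylGroup :=
  (l.map fun i => RootPairing.weylGroup.ofIdx P i).prod

variable {b : P.Base}

@[simp] theorem weylWord_nil : weylWord ([] : List b.support) = 1 := rfl

@[simp] theorem weylWord_cons (i : b.support) (l : List b.support) :
    weylWord (i :: l) = RootPairing.weylGroup.ofIdx P i * weylWord l := rfl

@[simp] theorem weylWord_append (l l' : List b.support) :
    weylWord (l ++ l') = weylWord l * weylWord l' := by
  simp [weylWord]

/-- The exchange argument. Letters are applied from the right end; look at the first one that makes
the root negative. A simple reflection keeps every positive root positive except its own simple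
root, so just before that letter `j` the root was `α_j`. -/
theorem exists_weylWord_smul_eq_of_not_isPos [Finite ι] [P.IsRootSystem] [P.IsCrystallographic]
    [P.IsReduced] (l : List b.support) (i : b.support)
    (h : ¬ b.IsPos (weylWord l • (i : ι))) :
    ∃ (l₁ : List b.support) (j : b.support) (l₂ : List b.support),
      l = l₁ ++ j :: l₂ ∧ weylWord l₂ • (i : ι) = j := by
  induction l with
  | nil => exact absurd (b.isPos_of_mem_support i.2) (by simpa using h)
  | cons a l ih =>
    by_cases hl : b.IsPos (weylWord l • (i : ι))
    · refine ⟨[], a, l, rfl, ?_⟩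
      by_contra hne
      refine h ?_
      rw [weylWord_cons, mul_smul, ofIdx_smul_index]
      exact hl.reflectionPerm a.2 hne
    · obtain ⟨l₁, j, l₂, rfl, hj⟩ := ih hl
      exact ⟨a :: l₁, j, l₂, rfl, hj⟩

theorem closure_ofIdx_support [Finite ι] [P.IsRootSystem] [P.IsCrystallographic] [P.IsReduced]
    (b : P.Base) :
    Subgroup.closure (Set.range fun i : b.support => RootPairing.weylGroup.ofIdx P i) = ⊤ := by
  set K := Subgroup.closure (Set.range fun i : b.support => RootPairing.weylGroup.ofIdx P i)
  have hK : ∀ i ∈ b.support, RootPairing.weylGroup.ofIdx P i ∈ K := fun i hi =>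
    Subgroup.subset_closure ⟨⟨i, hi⟩, rfl⟩
  have hconj : ∀ a c, RootPairing.weylGroup.ofIdx P (P.reflectionPerm a c) =
      RootPairing.weylGroup.ofIdx P a * RootPairing.weylGroup.ofIdx P c *
        (RootPairing.weylGroup.ofIdx P a)⁻¹ := fun a c => by
    rw [eq_mul_inv_iff_mul_eq, mul_ofIdx _ c, ofIdx_smul_index]
  have hmem : ∀ a, RootPairing.weylGroup.ofIdx P a ∈ K := fun a => by
    refine b.induction_reflect a (fun i hi => ?_) hK fun i j hi hj => ?_
    -- The negative of a root is its image under its own reflection.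
    · rw [hconj]
      exact mul_mem (mul_mem hi hi) (inv_mem hi)
    · rw [hconj]
      exact mul_mem (mul_mem (hK j hj) hi) (inv_mem (hK j hj))
  rw [eq_top_iff]
  rintro ⟨w, hw⟩ -
  induction hw using RootPairing.weylGroup.induction with
  | mem i => exact hmem i
  | one => exact one_mem _
  | mul x y hx hy hx' hy' => exact mul_mem hx' hy'

variable {Psi : Set E}

theorem IsMinusculeUnion.smul_mem (hPsi : IsMinusculeUnion b Psi) (w : P.weylGroup) {mu : E}
    (hmu : mu ∈ Psi) : w • mu ∈ Psi := by
  obtain ⟨S, -, rfl⟩ := hPsi.eq_union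
  simp only [Set.mem_iUnion] at hmu ⊢
  obtain ⟨lam, hlam, h⟩ := hmu
  exact ⟨lam, hlam, MulAction.mem_orbit_of_mem_orbit w h⟩

theorem IsMinusculeUnion.coroot'_apply (hPsi : IsMinusculeUnion b Psi) (a : ι) {mu : E}
    (hmu : mu ∈ Psi) : P.coroot' a mu = 0 ∨ P.coroot' a mu = 1 ∨ P.coroot' a mu = -1 := by
  obtain ⟨S, hS, rfl⟩ := hPsi.eq_union
  simp only [Set.mem_iUnion] at hmu
  obtain ⟨lam, hlam, w, rfl⟩ := hmu
  have := (hS lam hlam).coroot_apply (w⁻¹ • a)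
  rwa [← coroot'_smul w, smul_inv_smul] at this

theorem IsMinusculeUnion.exists_ne_zero (hPsi : IsMinusculeUnion b Psi) :
    ∃ mu ∈ Psi, mu ≠ 0 := by
  obtain ⟨S, hS, h⟩ := hPsi.eq_union
  obtain ⟨mu, hmu⟩ := hPsi.nonempty
  rw [h] at hmu
  simp only [Set.mem_iUnion] at hmu
  obtain ⟨lam, hlam, -⟩ := hmu
  refine ⟨lam, ?_, (hS lam hlam).ne_zero⟩
  rw [h]
  exact Set.mem_biUnion hlam (MulAction.mem_orbit_self lam)

/-- The action of the Weyl group on a union of orbits of minuscule weights. -/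
def act (hPsi : IsMinusculeUnion b Psi) (w : P.weylGroup) (mu : Psi) : Psi :=
  ⟨w • (mu : E), hPsi.smul_mem w mu.2⟩

@[simp] theorem coe_act (hPsi : IsMinusculeUnion b Psi) (w : P.weylGroup) (mu : Psi) :
    (act hPsi w mu : E) = w • (mu : E) := rfl

theorem act_mul (hPsi : IsMinusculeUnion b Psi) (w w' : P.weylGroup) (mu : Psi) :
    act hPsi (w * w') mu = act hPsi w (act hPsi w' mu) :=
  Subtype.ext (mul_smul w w' (mu : E))

@[simp] theorem act_one (hPsi : IsMinusculeUnion b Psi) (mu : Psi) : act hPsi 1 mu = mu :=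
  Subtype.ext (one_smul _ (mu : E))

theorem act_inv_act (hPsi : IsMinusculeUnion b Psi) (w : P.weylGroup) (mu : Psi) :
    act hPsi w (act hPsi w⁻¹ mu) = mu := by
  rw [← act_mul, mul_inv_cancel, act_one]

/-- The span is stable under all reflections and nonzero, as minuscule weights are nonzero;
irreducibility leaves only the whole space. -/
theorem span_eq_top [P.IsIrreducible] (hPsi : IsMinusculeUnion b Psi) :
    Submodule.span ℚ Psi = ⊤ := by
  refine RootPairing.IsIrreducible.eq_top_of_invtSubmodule_reflection (P := P) _ (fun a => ?_) ?_
  · rw [Module.End.mem_invtSubmodule, Submodule.span_le]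
    intro mu hmu
    exact Submodule.subset_span (hPsi.smul_mem (RootPairing.weylGroup.ofIdx P a) hmu)
  · obtain ⟨mu, hmu, h0⟩ := hPsi.exists_ne_zero
    intro h
    exact h0 ((Submodule.mem_bot ℚ).1 (h ▸ Submodule.subset_span hmu))

theorem act_injective [P.IsIrreducible] (hPsi : IsMinusculeUnion b Psi) :
    Function.Injective (act hPsi) := by
  intro w w' hw
  refine Subtype.ext <| RootPairing.Equiv.weightHom_injective P <|
    LinearEquiv.toLinearMap_injective <| LinearMap.ext_on (span_eq_top hPsi) fun mu hmu => ?_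
  exact congrArg Subtype.val (congrFun hw ⟨mu, hmu⟩)

end WeylGroup

/-! ### Monomial action of `N`, normality of `H`, and words in the `n_i` -/

section Monomial

open RootPairing.weylGroup (ofIdx)

variable {ι E E' : Type*} [AddCommGroup E] [Module ℚ E] [AddCommGroup E'] [Module ℚ E']
  {P : RootPairing ι ℚ E E'} {b : P.Base} {Psi : Set E}
  {R V : Type*} [CommRing R] [AddCommGroup V] [Module R V]
  (hPsi : IsMinusculeUnion b Psi) (z : Basis Psi R V)

theorem coroot'_ofIdx_smul (i j : ι) (v : E) :
    P.coroot' j (ofIdx P i • v) = P.coroot' j v - P.coroot' i v * P.pairing i j := by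
  rw [ofIdx_smul_eq_sub, map_sub, map_smul, P.root_coroot'_eq_pairing, smul_eq_mul]

theorem coroot'_ofIdx_smul_self (i : ι) (v : E) :
    P.coroot' i (ofIdx P i • v) = -P.coroot' i v := by
  rw [coroot'_ofIdx_smul, P.pairing_same]; ring

theorem act_ofIdx_of_eq_zero {i : ι} {mu : Psi} (hmu : P.coroot' i mu = 0) :
    act hPsi (ofIdx P i) mu = mu :=
  Subtype.ext <| by rw [coe_act, ofIdx_smul_eq_sub, hmu, zero_smul, sub_zero]

theorem act_ofIdx_act_ofIdx (i : ι) (mu : Psi) :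
    act hPsi (ofIdx P i) (act hPsi (ofIdx P i) mu) = mu := by
  rw [← act_mul, ofIdx_mul_self, act_one]

theorem e_apply {i : b.support} {mu : Psi} (hmu : P.coroot' i mu = -1) :
    e hPsi z i (z mu) = z (act hPsi (ofIdx P i) mu) := by
  rw [e, Basis.constr_basis, dif_pos hmu]
  congr 1
  exact Subtype.ext (by simp only [coe_act, ofIdx_smul_eq_sub, hmu]; module)

theorem e_apply_eq_zero {i : b.support} {mu : Psi} (hmu : P.coroot' i mu ≠ -1) :
    e hPsi z i (z mu) = 0 := by
  rw [e, Basis.constr_basis, dif_neg hmu]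

theorem f_apply {i : b.support} {mu : Psi} (hmu : P.coroot' i mu = 1) :
    f hPsi z i (z mu) = z (act hPsi (ofIdx P i) mu) := by
  rw [f, Basis.constr_basis, dif_pos hmu]
  congr 1
  exact Subtype.ext (by simp only [coe_act, ofIdx_smul_eq_sub, hmu]; module)

theorem f_apply_eq_zero {i : b.support} {mu : Psi} (hmu : P.coroot' i mu ≠ 1) :
    f hPsi z i (z mu) = 0 := by
  rw [f, Basis.constr_basis, dif_neg hmu]

theorem x_apply (i : b.support) (t : R) (v : V) :
    (x hPsi z i t : V →ₗ[R] V) v = v + t • e hPsi z i v := rfl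

theorem y_apply (i : b.support) (t : R) (v : V) :
    (y hPsi z i t : V →ₗ[R] V) v = v + t • f hPsi z i v := rfl

/-- The scalar by which `n_i(t)` acts on a basis vector whose weight pairs to `q` with `α_i^∨`. -/
def nCoeff (q : ℚ) (t : Rˣ) : Rˣ :=
  if q = 1 then -t⁻¹ else if q = -1 then t else 1

/-- Pairings with `α_i^∨` are `0` or `±1`, so `e_i` and `f_i` kill `z_mu` or act on the plane of
`z_mu` and `z_{s_i mu}` as the elementary matrices of `SL₂`. -/
theorem n_apply (i : b.support) (t : Rˣ) (mu : Psi) :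
    (n hPsi z i t : V →ₗ[R] V) (z mu) =
      nCoeff (P.coroot' i mu) t • z (act hPsi (ofIdx P i) mu) := by
  have hs : P.coroot' i (act hPsi (ofIdx P i) mu) = -P.coroot' i mu :=
    coroot'_ofIdx_smul_self (i : ι) (mu : E)
  rw [n, Units.val_mul, Units.val_mul, Module.End.mul_apply, Module.End.mul_apply,
    Units.smul_def]
  simp only [x_apply, y_apply]
  rcases hPsi.coroot'_apply i mu.2 with hmu | hmu | hmu
  · rw [e_apply_eq_zero hPsi z (by rw [hmu]; norm_num), smul_zero, add_zero,
      f_apply_eq_zero hPsi z (by rw [hmu]; norm_num), smul_zero, add_zero,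
      e_apply_eq_zero hPsi z (by rw [hmu]; norm_num), smul_zero, add_zero,
      act_ofIdx_of_eq_zero hPsi hmu, hmu, nCoeff, if_neg (by norm_num), if_neg (by norm_num),
      Units.val_one, one_smul]
  · rw [e_apply_eq_zero hPsi z (by rw [hmu]; norm_num), smul_zero, add_zero,
      f_apply hPsi z hmu, map_add, map_smul,
      e_apply_eq_zero hPsi z (by rw [hmu]; norm_num),
      e_apply hPsi z (by rw [hs, hmu]), act_ofIdx_act_ofIdx, hmu, nCoeff, if_pos rfl,
      zero_add, smul_smul, mul_neg, Units.mul_inv, Units.val_neg]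
    module
  · rw [e_apply hPsi z hmu, map_add, map_smul,
      f_apply_eq_zero hPsi z (by rw [hmu]; norm_num),
      f_apply hPsi z (by rw [hs, hmu]; norm_num), act_ofIdx_act_ofIdx, zero_add, smul_smul,
      neg_mul, Units.inv_mul, map_add, map_add, map_smul, map_smul, e_apply hPsi z hmu,
      e_apply_eq_zero hPsi z (by rw [hs, hmu]; norm_num), hmu, nCoeff, if_neg (by norm_num),
      if_pos rfl]
    module

theorem map_units_smul (g : V →ₗ[R] V) (u : Rˣ) (v : V) : g (u • v) = u • g v :=
  map_smul g (u : R) v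

theorem h_apply (i : b.support) (t : Rˣ) (mu : Psi) {m : ℤ} (hm : P.coroot' i mu = m) :
    (h hPsi z i t : V →ₗ[R] V) (z mu) = t ^ m • z mu := by
  have hs : P.coroot' i (act hPsi (ofIdx P i) mu) = -P.coroot' i mu :=
    coroot'_ofIdx_smul_self (i : ι) (mu : E)
  rw [h, Units.val_mul, Module.End.mul_apply, n_apply, map_units_smul, n_apply,
    act_ofIdx_act_ofIdx, hs, ← mul_smul]
  congr 1
  rcases hPsi.coroot'_apply i mu.2 with hmu | hmu | hmu
  · obtain rfl : m = 0 := by exact_mod_cast hm.symm.trans hmu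
    simp [hmu, nCoeff]
  · obtain rfl : m = 1 := by exact_mod_cast hm.symm.trans hmu
    rw [hmu, nCoeff, nCoeff, if_pos rfl, if_neg (by norm_num), if_pos rfl]
    simp
  · obtain rfl : m = -1 := by exact_mod_cast hm.symm.trans hmu
    rw [hmu, nCoeff, nCoeff, if_neg (by norm_num), if_pos rfl, neg_neg, if_pos rfl]
    simp

theorem exists_coroot'_eq_intCast (hPsi : IsMinusculeUnion b Psi) (a : ι) (mu : Psi) :
    ∃ m : ℤ, P.coroot' a mu = m := by
  rcases hPsi.coroot'_apply a mu.2 with hmu | hmu | hmu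
  · exact ⟨0, by simp [hmu]⟩
  · exact ⟨1, by simp [hmu]⟩
  · exact ⟨-1, by simp [hmu]⟩

theorem generalLinearGroup_ext {κ R V : Type*} [CommRing R] [AddCommGroup V] [Module R V]
    {z : Basis κ R V} {g g' : LinearMap.GeneralLinearGroup R V}
    (hg : ∀ mu, (g : V →ₗ[R] V) (z mu) = (g' : V →ₗ[R] V) (z mu)) : g = g' :=
  Units.ext (z.ext hg)

theorem n_neg (i : b.support) (t : Rˣ) : n hPsi z i (-t) = (n hPsi z i t)⁻¹ := by
  rw [eq_inv_iff_mul_eq_one]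
  refine generalLinearGroup_ext (z := z) fun mu => ?_
  have hs : P.coroot' i (act hPsi (ofIdx P i) mu) = -P.coroot' i mu :=
    coroot'_ofIdx_smul_self (i : ι) (mu : E)
  rw [Units.val_mul, Module.End.mul_apply, n_apply, map_units_smul, n_apply,
    act_ofIdx_act_ofIdx, hs, ← mul_smul, Units.val_one, Module.End.one_apply]
  convert one_smul Rˣ (z mu) using 2
  rcases hPsi.coroot'_apply i mu.2 with hmu | hmu | hmu
  · simp [hmu, nCoeff]
  · rw [hmu, nCoeff, nCoeff, if_pos rfl, if_neg (by norm_num), if_pos rfl]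
    simp
  · rw [hmu, nCoeff, nCoeff, if_neg (by norm_num), if_pos rfl, neg_neg, if_pos rfl]
    simp

theorem n_eq_h_mul_n_one (i : b.support) (t : Rˣ) :
    n hPsi z i t = h hPsi z i t * n hPsi z i 1 := by
  rw [h, n_neg, inv_mul_cancel_right]

/-- Multiplicative form of `s_i(α_j^∨) = α_j^∨ - (α_i, α_j^∨) α_i^∨`, since `h_j(t)` scales `z_mu`
by `t ^ (mu, α_j^∨)`. -/
theorem n_mul_h [P.IsCrystallographic] (i j : b.support) (s t : Rˣ) :
    n hPsi z i s * h hPsi z j t =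
      h hPsi z j t * h hPsi z i (t ^ (-P.pairingIn ℤ i j)) * n hPsi z i s := by
  refine generalLinearGroup_ext (z := z) fun mu => ?_
  obtain ⟨k, hk⟩ := exists_coroot'_eq_intCast hPsi i mu
  obtain ⟨m, hm⟩ := exists_coroot'_eq_intCast hPsi j mu
  have hki : P.coroot' i (act hPsi (ofIdx P i) mu) = ((-k : ℤ) : ℚ) := by
    rw [coe_act, coroot'_ofIdx_smul_self, hk]; push_cast; rfl
  have hmj : P.coroot' j (act hPsi (ofIdx P i) mu) =
      ((m - k * P.pairingIn ℤ i j : ℤ) : ℚ) := by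
    rw [coe_act, coroot'_ofIdx_smul, hk, hm]
    push_cast
    rw [← P.algebraMap_pairingIn ℤ i j]
    rfl
  simp only [Units.val_mul, Module.End.mul_apply]
  rw [h_apply hPsi z j t mu hm, map_units_smul, n_apply, map_units_smul, map_units_smul,
    h_apply hPsi z i _ _ hki, map_units_smul, h_apply hPsi z j _ _ hmj, ← mul_smul, ← mul_smul,
    ← mul_smul, ← zpow_mul]
  congr 1
  rw [mul_comm, mul_assoc, ← zpow_add]
  congr 2
  ring

theorem h_mem_H (i : b.support) (t : Rˣ) : h hPsi z i t ∈ H hPsi z :=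
  Subgroup.subset_closure ⟨i, t, rfl⟩

theorem n_conj_mem_H [P.IsCrystallographic] (i : b.support) (s : Rˣ)
    {g : LinearMap.GeneralLinearGroup R V} (hg : g ∈ H hPsi z) :
    n hPsi z i s * g * (n hPsi z i s)⁻¹ ∈ H hPsi z := by
  suffices H hPsi z ≤ (H hPsi z).comap (MulAut.conj (n hPsi z i s)).toMonoidHom from this hg
  conv_lhs => rw [H]
  refine (Subgroup.closure_le _).2 ?_
  rintro _ ⟨j, t, rfl⟩
  change n hPsi z i s * h hPsi z j t * (n hPsi z i s)⁻¹ ∈ H hPsi z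
  rw [n_mul_h, mul_inv_cancel_right]
  exact mul_mem (h_mem_H hPsi z _ _) (h_mem_H hPsi z _ _)

theorem N_le_normalizer_H [P.IsCrystallographic] :
    N hPsi z ≤ Subgroup.normalizer (H hPsi z : Set (LinearMap.GeneralLinearGroup R V)) := by
  refine (Subgroup.closure_le _).2 ?_
  rintro _ ⟨i, s, rfl⟩
  refine Subgroup.mem_normalizer_iff.2 fun g => ⟨n_conj_mem_H hPsi z i s, fun hg => ?_⟩
  have := n_conj_mem_H hPsi z i (-s) hg
  rw [n_neg] at this
  simpa [mul_assoc] using this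

theorem conj_mem_H [P.IsCrystallographic] {g k : LinearMap.GeneralLinearGroup R V}
    (hg : g ∈ N hPsi z) (hk : k ∈ H hPsi z) : g * k * g⁻¹ ∈ H hPsi z :=
  (Subgroup.mem_normalizer_iff.1 (N_le_normalizer_H hPsi z hg) k).1 hk

/-- The element of `N` given by a word in the `n_i`. -/
def nWord (l : List b.support) : LinearMap.GeneralLinearGroup R V :=
  (l.map fun i => n hPsi z i 1).prod

@[simp] theorem nWord_nil : nWord hPsi z [] = 1 := rfl

@[simp] theorem nWord_cons (i : b.support) (l : List b.support) :
    nWord hPsi z (i :: l) = n hPsi z i 1 * nWord hPsi z l := rfl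

@[simp] theorem nWord_append (l l' : List b.support) :
    nWord hPsi z (l ++ l') = nWord hPsi z l * nWord hPsi z l' := by
  simp [nWord]

theorem nWord_mem_N (l : List b.support) : nWord hPsi z l ∈ N hPsi z :=
  list_prod_mem <| by
    intro g hg
    obtain ⟨i, -, rfl⟩ := List.mem_map.1 hg
    exact n_mem_N hPsi z i 1

theorem exists_eq_mul_nWord [P.IsCrystallographic] {g : LinearMap.GeneralLinearGroup R V}
    (hg : g ∈ N hPsi z) : ∃ k ∈ H hPsi z, ∃ l, g = k * nWord hPsi z l := by
  have step : ∀ (i : b.support) (t : Rˣ) (g : LinearMap.GeneralLinearGroup R V),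
      (∃ k ∈ H hPsi z, ∃ l, g = k * nWord hPsi z l) →
        ∃ k ∈ H hPsi z, ∃ l, n hPsi z i t * g = k * nWord hPsi z l := by
    rintro i t _ ⟨k, hk, l, rfl⟩
    refine ⟨n hPsi z i t * k * (n hPsi z i t)⁻¹ * h hPsi z i t,
      mul_mem (n_conj_mem_H hPsi z i t hk) (h_mem_H hPsi z i t), i :: l, ?_⟩
    rw [nWord_cons, mul_assoc _ (h hPsi z i t), ← mul_assoc (h hPsi z i t),
      ← n_eq_h_mul_n_one]
    group
  induction hg using Subgroup.closure_induction_left with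
  | one => exact ⟨1, one_mem _, [], by simp⟩
  | mul_left a ha g _ ih =>
    obtain ⟨i, t, rfl⟩ := ha
    exact step i t g ih
  | inv_mul_cancel a ha g _ ih =>
    obtain ⟨i, t, rfl⟩ := ha
    -- Inverses of generators are again generators, so the same step applies.
    rw [← n_neg]
    exact step i _ g ih

/-- The sign by which a word in the `n_i` acts on a basis vector. -/
def wordSign : List b.support → Psi → ℤˣ
  | [], _ => 1
  | i :: l, mu => nCoeff (P.coroot' i (act hPsi (weylWord l) mu)) (1 : ℤˣ) * wordSign l mu

theorem nCoeff_one_smul (q : ℚ) (v : V) :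
    nCoeff q (1 : Rˣ) • v = nCoeff q (1 : ℤˣ) • v := by
  unfold nCoeff
  split_ifs <;> simp [Units.smul_def]

theorem map_int_units_smul (g : V →ₗ[R] V) (u : ℤˣ) (v : V) : g (u • v) = u • g v :=
  map_zsmul g (u : ℤ) v

theorem nWord_apply (l : List b.support) (mu : Psi) :
    (nWord hPsi z l : V →ₗ[R] V) (z mu) =
      wordSign hPsi l mu • z (act hPsi (weylWord l) mu) := by
  induction l with
  | nil => simp [wordSign]
  | cons i l ih =>
    rw [nWord_cons, Units.val_mul, Module.End.mul_apply, ih, map_int_units_smul, n_apply,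
      nCoeff_one_smul, ← mul_smul, weylWord_cons, act_mul, wordSign, mul_comm]

end Monomial

/-! ### Triangular span in a Lie algebra, from the Chevalley relations without Serre relations -/

section IteratedBrackets

variable {I K L : Type*} [CommRing K] [LieRing L] [LieAlgebra K L]

/-- The iterated brackets `[a_i, [a_j, ..., [a_k, a_l]]]` in the members of a family `a`. -/
inductive IteratedBracket (a : I → L) : L → Prop
  | base (i : I) : IteratedBracket a (a i)
  | step (i : I) {v : L} (hv : IteratedBracket a v) : IteratedBracket a ⁅a i, v⁆

/-- The relations between two families `a`, `c` of raising and lowering operators. -/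
structure ChevalleyRelations (K : Type*) {I L : Type*} [CommRing K] [LieRing L] [LieAlgebra K L]
    (a c : I → L) : Prop where
  lie_of_ne : ∀ i j, i ≠ j → ⁅a i, c j⁆ = 0
  left : ∀ i j, ∃ k : K, ⁅⁅a i, c i⁆, a j⁆ = k • a j
  right : ∀ i j, ∃ k : K, ⁅⁅a i, c i⁆, c j⁆ = k • c j

/-- The span of the iterated brackets in `a`, those in `c`, and the elements `[a_i, c_i]`. -/
def triangularSpan (K : Type*) {I L : Type*} [CommRing K] [LieRing L] [LieAlgebra K L]
    (a c : I → L) : Submodule K L :=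
  Submodule.span K ({v | IteratedBracket a v} ∪ Set.range (fun i => ⁅a i, c i⁆) ∪
    {v | IteratedBracket c v})

variable {a c : I → L}

theorem ChevalleyRelations.symm (hac : ChevalleyRelations K a c) : ChevalleyRelations K c a where
  lie_of_ne i j hij := by rw [← lie_skew, hac.lie_of_ne j i hij.symm, neg_zero]
  left i j := by
    obtain ⟨k, hk⟩ := hac.right i j
    exact ⟨-k, by rw [← lie_skew (c i), neg_lie, hk, neg_smul]⟩
  right i j := by
    obtain ⟨k, hk⟩ := hac.left i j
    exact ⟨-k, by rw [← lie_skew (c i), neg_lie, hk, neg_smul]⟩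

theorem triangularSpan_symm (K : Type*) {I L : Type*} [CommRing K] [LieRing L] [LieAlgebra K L]
    (a c : I → L) : triangularSpan K c a ≤ triangularSpan K a c := by
  refine Submodule.span_le.2 ?_
  rintro v ((hv | ⟨i, rfl⟩) | hv)
  · exact Submodule.subset_span (Or.inr hv)
  · change ⁅c i, a i⁆ ∈ _
    rw [← lie_skew]
    exact neg_mem (Submodule.subset_span (Or.inl (Or.inr ⟨i, rfl⟩)))
  · exact Submodule.subset_span (Or.inl (Or.inl hv))

theorem ChevalleyRelations.lie_iteratedBracket (hac : ChevalleyRelations K a c) (i : I) {v : L}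
    (hv : IteratedBracket a v) : ∃ k : K, ⁅⁅a i, c i⁆, v⁆ = k • v := by
  induction hv with
  | base j => exact hac.left i j
  | step j hv ih =>
    obtain ⟨k, hk⟩ := hac.left i j
    obtain ⟨k', hk'⟩ := ih
    exact ⟨k + k', by rw [leibniz_lie, hk, hk', lie_smul, smul_lie, add_smul]⟩

/-- By Leibniz, `[c_j, [a_i, v]] = [[c_j, a_i], v] + [a_i, [c_j, v]]`. The first term is `0` or a
multiple of `v`; in the second, induction applies, and `[a_i, [a_k, c_k]]` is a multiple of `a_i`.
-/
theorem ChevalleyRelations.lie_lower_mem (hac : ChevalleyRelations K a c) (j : I) {v : L}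
    (hv : IteratedBracket a v) :
    ⁅c j, v⁆ ∈ Submodule.span K ({v | IteratedBracket a v} ∪ Set.range fun i => ⁅a i, c i⁆) := by
  classical
  induction hv with
  | base i =>
    rw [← lie_skew]
    refine neg_mem ?_
    rcases eq_or_ne i j with rfl | hij
    · exact Submodule.subset_span (Or.inr ⟨i, rfl⟩)
    · rw [hac.lie_of_ne i j hij]
      exact zero_mem _
  | @step i v hv ih =>
    rw [leibniz_lie]
    refine add_mem ?_ ?_
    · rw [← lie_skew (c j), neg_lie]
      refine neg_mem ?_
      rcases eq_or_ne i j with rfl | hij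
      · obtain ⟨k, hk⟩ := hac.lie_iteratedBracket i hv
        rw [hk]
        exact Submodule.smul_mem _ _ (Submodule.subset_span (Or.inl hv))
      · rw [hac.lie_of_ne i j hij, zero_lie]
        exact zero_mem _
    · generalize ⁅c j, v⁆ = u at ih
      induction ih using Submodule.span_induction with
      | mem w hw =>
        rcases hw with hw | ⟨k, rfl⟩
        · exact Submodule.subset_span (Or.inl (IteratedBracket.step i hw))
        · obtain ⟨q, hq⟩ := hac.left k i
          rw [← lie_skew, hq]
          exact neg_mem (Submodule.smul_mem _ _ (Submodule.subset_span (Or.inl (.base i))))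
      | zero => rw [lie_zero]; exact zero_mem _
      | add _ _ _ _ h1 h2 => rw [lie_add]; exact add_mem h1 h2
      | smul q _ _ h1 => rw [lie_smul]; exact Submodule.smul_mem _ _ h1

theorem ChevalleyRelations.lie_left_mem (hac : ChevalleyRelations K a c) (i : I) {v : L}
    (hv : v ∈ triangularSpan K a c) : ⁅a i, v⁆ ∈ triangularSpan K a c := by
  induction hv using Submodule.span_induction with
  | mem w hw =>
    rcases hw with (hw | ⟨k, rfl⟩) | hw
    · exact Submodule.subset_span (Or.inl (Or.inl (IteratedBracket.step i hw)))
    · obtain ⟨q, hq⟩ := hac.left k i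
      rw [← lie_skew, hq]
      exact neg_mem (Submodule.smul_mem _ _ (Submodule.subset_span (Or.inl (Or.inl (.base i)))))
    · exact triangularSpan_symm K a c
        (Submodule.span_mono Set.subset_union_left (hac.symm.lie_lower_mem i hw))
  | zero => rw [lie_zero]; exact zero_mem _
  | add _ _ _ _ h1 h2 => rw [lie_add]; exact add_mem h1 h2
  | smul q _ _ h1 => rw [lie_smul]; exact Submodule.smul_mem _ _ h1

theorem ChevalleyRelations.lie_right_mem (hac : ChevalleyRelations K a c) (i : I) {v : L}
    (hv : v ∈ triangularSpan K a c) : ⁅c i, v⁆ ∈ triangularSpan K a c :=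
  triangularSpan_symm K a c (hac.symm.lie_left_mem i (triangularSpan_symm K c a hv))

end IteratedBrackets

attribute [local instance] LieRing.ofAssociativeRing

/-! ### Height grading and coefficients along a simple root -/

section Height

open RootPairing.weylGroup (ofIdx)

variable {ι E E' : Type*} [AddCommGroup E] [Module ℚ E] [AddCommGroup E'] [Module ℚ E']
  {P : RootPairing ι ℚ E E'} {b : P.Base} {Psi : Set E}
  {R V : Type*} [CommRing R] [AddCommGroup V] [Module R V]

/-- The operators which raise the value of `ht` on weights by `k`. -/
def HasHeight (z : Basis Psi R V) (ht : E →ₗ[ℚ] ℚ) (k : ℚ) (A : Module.End R V) : Prop :=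
  ∀ q : ℚ, ∀ v ∈ Submodule.span R (z '' {mu : Psi | ht mu = q}),
    A v ∈ Submodule.span R (z '' {mu : Psi | ht mu = q + k})

variable {z : Basis Psi R V} {ht : E →ₗ[ℚ] ℚ}

theorem HasHeight.of_basis {k : ℚ} {A : Module.End R V}
    (hA : ∀ mu : Psi, A (z mu) ∈ Submodule.span R (z '' {nu : Psi | ht nu = ht mu + k})) :
    HasHeight z ht k A := by
  intro q
  change Submodule.span R _ ≤ (Submodule.span R _).comap A
  refine Submodule.span_le.2 ?_
  rintro _ ⟨mu, rfl, rfl⟩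
  exact hA mu

theorem HasHeight.lie {k l : ℚ} {A B : Module.End R V} (hA : HasHeight z ht k A)
    (hB : HasHeight z ht l B) : HasHeight z ht (k + l) ⁅A, B⁆ := by
  intro q v hv
  have h1 := hA _ _ (hB _ _ hv)
  have h2 := hB _ _ (hA _ _ hv)
  rw [Ring.lie_def, LinearMap.sub_apply, Module.End.mul_apply, Module.End.mul_apply]
  rw [add_assoc, add_comm l k] at h1
  rw [add_assoc] at h2
  exact sub_mem h1 h2

theorem HasHeight.repr_eq_zero {k : ℚ} {A : Module.End R V} (hA : HasHeight z ht k A) (mu nu : Psi)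
    (hne : ht nu ≠ ht mu + k) : z.repr (A (z mu)) nu = 0 := by
  have := hA _ _ (Submodule.subset_span ⟨mu, rfl, rfl⟩)
  rw [Basis.mem_span_image] at this
  by_contra h0
  exact hne (this (Finsupp.mem_support_iff.2 h0))

variable (hPsi : IsMinusculeUnion b Psi)

theorem hasHeight_e (z : Basis Psi R V) (ht : E →ₗ[ℚ] ℚ) (i : b.support) :
    HasHeight z ht (ht (P.root i)) (e hPsi z i) := by
  refine HasHeight.of_basis fun mu => ?_
  by_cases hmu : P.coroot' i mu = -1
  · rw [e_apply hPsi z hmu]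
    refine Submodule.subset_span ⟨_, ?_, rfl⟩
    simp [ofIdx_smul_eq_sub, hmu, -RootPairing.weylGroup.ofIdx_smul]
  · rw [e_apply_eq_zero hPsi z hmu]
    exact zero_mem _

theorem hasHeight_f (z : Basis Psi R V) (ht : E →ₗ[ℚ] ℚ) (i : b.support) :
    HasHeight z ht (-ht (P.root i)) (f hPsi z i) := by
  refine HasHeight.of_basis fun mu => ?_
  by_cases hmu : P.coroot' i mu = 1
  · rw [f_apply hPsi z hmu]
    refine Submodule.subset_span ⟨_, ?_, rfl⟩
    simp [ofIdx_smul_eq_sub, hmu, -RootPairing.weylGroup.ofIdx_smul, sub_eq_add_neg]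
  · rw [f_apply_eq_zero hPsi z hmu]
    exact zero_mem _

/-- The operators `A` such that the coefficient of `z_{mu + α_j}` in `A z_mu` is the same for all
`mu` with `(mu, α_j^∨) = -1`. -/
def constantCoeff (z : Basis Psi R V) (j : b.support) : Submodule R (Module.End R V) where
  carrier := {A | ∀ mu nu : Psi, P.coroot' j mu = -1 → P.coroot' j nu = -1 →
    z.repr (A (z mu)) (act hPsi (ofIdx P j) mu) = z.repr (A (z nu)) (act hPsi (ofIdx P j) nu)}
  zero_mem' := by simp
  add_mem' := by
    intro A B hA hB mu nu hmu hnu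
    simp [hA mu nu hmu hnu, hB mu nu hmu hnu]
  smul_mem' := by
    intro t A hA mu nu hmu hnu
    simp [hA mu nu hmu hnu]

/-- Passing from `mu` to `mu + α_j` changes the height by `ht α_j`, so for any other shift `k` all
these coefficients vanish. -/
theorem HasHeight.mem_constantCoeff {k : ℚ} {A : Module.End R V} (hA : HasHeight z ht k A)
    (j : b.support) (hk : k ≠ ht (P.root j)) : A ∈ constantCoeff hPsi z j := by
  have key : ∀ mu : Psi, P.coroot' j mu = -1 →
      z.repr (A (z mu)) (act hPsi (ofIdx P j) mu) = 0 := fun mu hmu => by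
    refine hA.repr_eq_zero _ _ fun h => hk ?_
    rw [coe_act, ofIdx_smul_eq_sub, hmu, map_sub, map_smul, smul_eq_mul] at h
    linarith
  intro mu nu hmu hnu
  rw [key mu hmu, key nu hnu]

theorem e_mem_constantCoeff (z : Basis Psi R V) (i j : b.support) :
    e hPsi z i ∈ constantCoeff hPsi z j := by
  classical
  intro mu nu hmu hnu
  rcases eq_or_ne i j with rfl | hij
  · rw [e_apply hPsi z hmu, e_apply hPsi z hnu]
    simp
  -- For `i ≠ j` the weights `mu + α_i` and `mu + α_j` differ, so the coefficient is zero although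
  -- the heights may agree.
  · have key : ∀ mu : Psi, P.coroot' j mu = -1 →
        z.repr (e hPsi z i (z mu)) (act hPsi (ofIdx P j) mu) = 0 := fun mu hmu => by
      by_cases hi : P.coroot' i mu = -1
      · rw [e_apply hPsi z hi, Basis.repr_self, Finsupp.single_eq_of_ne]
        intro h
        have h1 := congrArg Subtype.val h
        rw [coe_act, coe_act, ofIdx_smul_eq_sub, ofIdx_smul_eq_sub, hi, hmu, neg_one_smul,
          neg_one_smul, sub_neg_eq_add, sub_neg_eq_add, add_right_inj] at h1
        exact hij (Subtype.ext (P.root.injective h1.symm))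
      · rw [e_apply_eq_zero hPsi z hi]
        simp
    rw [key mu hmu, key nu hnu]

/-- The first conjunct feeds the induction: bracketing with `e_i` raises a height of at least `1` to
at least `2`. -/
theorem iteratedBracket_e_eq_or_hasHeight (z : Basis Psi R V)
    (hht : ∀ i : b.support, ht (P.root i) = 1) {A : Module.End R V}
    (hA : IteratedBracket (L := Module.End R V) (e hPsi z) A) :
    (∃ k, 1 ≤ k ∧ HasHeight z ht k A) ∧
      ((∃ i, A = e hPsi z i) ∨ ∃ k, 2 ≤ k ∧ HasHeight z ht k A) := by
  induction hA with
  | base i => exact ⟨⟨_, (hht i).ge, hasHeight_e hPsi z ht i⟩, Or.inl ⟨i, rfl⟩⟩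
  | step i _ ih =>
    obtain ⟨⟨k, hk, hA⟩, -⟩ := ih
    have := (hasHeight_e hPsi z ht i).lie hA
    rw [hht i] at this
    exact ⟨⟨_, by linarith, this⟩, Or.inr ⟨_, by linarith, this⟩⟩

theorem iteratedBracket_f_hasHeight (z : Basis Psi R V)
    (hht : ∀ i : b.support, ht (P.root i) = 1) {A : Module.End R V}
    (hA : IteratedBracket (L := Module.End R V) (f hPsi z) A) : ∃ k, k ≤ -1 ∧ HasHeight z ht k A := by
  induction hA with
  | base i => exact ⟨_, by rw [hht i], hasHeight_f hPsi z ht i⟩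
  | step i _ ih =>
    obtain ⟨k, hk, hA⟩ := ih
    have := (hasHeight_f hPsi z ht i).lie hA
    rw [hht i] at this
    exact ⟨_, by linarith, this⟩

theorem triangularSpan_le_constantCoeff [P.IsRootSystem] (z : Basis Psi R V) (j : b.support) :
    triangularSpan R (L := Module.End R V) (e hPsi z) (f hPsi z) ≤ constantCoeff hPsi z j := by
  -- The simple roots form a basis of `E`, so the height extends linearly to all weights.
  obtain ⟨ht, hht⟩ : ∃ ht : E →ₗ[ℚ] ℚ, ∀ i : b.support, ht (P.root i) = 1 :=
    ⟨b.toWeightBasis.constr ℚ fun _ => 1, fun i => by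
      rw [← b.toWeightBasis_apply, Basis.constr_basis]⟩
  refine Submodule.span_le.2 ?_
  rintro A ((hA | ⟨i, rfl⟩) | hA)
  · rcases (iteratedBracket_e_eq_or_hasHeight hPsi z hht hA).2 with ⟨i, rfl⟩ | ⟨k, hk, hA⟩
    · exact e_mem_constantCoeff hPsi z i j
    · exact hA.mem_constantCoeff hPsi j (by rw [hht]; linarith)
  · exact ((hasHeight_e hPsi z ht i).lie (hasHeight_f hPsi z ht i)).mem_constantCoeff hPsi j
      (by rw [hht, hht]; norm_num)
  · obtain ⟨k, hk, hA⟩ := iteratedBracket_f_hasHeight hPsi z hht hA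
    exact hA.mem_constantCoeff hPsi j (by rw [hht]; linarith)

end Height

/-! ### Chevalley relations over `ℚ` and constancy of the sign -/

section Signs

open RootPairing.weylGroup (ofIdx)

variable {ι E E' : Type*} [AddCommGroup E] [Module ℚ E] [AddCommGroup E'] [Module ℚ E']
  {P : RootPairing ι ℚ E E'} {b : P.Base} {Psi : Set E}
  {V : Type*} [AddCommGroup V] [Module ℚ V]
  (hPsi : IsMinusculeUnion b Psi) (z : Basis Psi ℚ V)

theorem lie_e_f_apply (i : b.support) (mu : Psi) :
    ⁅(e hPsi z i : Module.End ℚ V), f hPsi z i⁆ (z mu) = P.coroot' i mu • z mu := by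
  have hs : P.coroot' i (act hPsi (ofIdx P i) mu) = -P.coroot' i mu :=
    coroot'_ofIdx_smul_self (i : ι) (mu : E)
  rw [Ring.lie_def, LinearMap.sub_apply, Module.End.mul_apply, Module.End.mul_apply]
  rcases hPsi.coroot'_apply i mu.2 with hmu | hmu | hmu
  · rw [e_apply_eq_zero hPsi z (by rw [hmu]; norm_num),
      f_apply_eq_zero hPsi z (by rw [hmu]; norm_num), hmu]
    simp
  · rw [e_apply_eq_zero hPsi z (by rw [hmu]; norm_num), f_apply hPsi z hmu,
      e_apply hPsi z (by rw [hs, hmu]), act_ofIdx_act_ofIdx, hmu]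
    simp
  · rw [f_apply_eq_zero hPsi z (by rw [hmu]; norm_num), e_apply hPsi z hmu,
      f_apply hPsi z (by rw [hs, hmu]; norm_num), act_ofIdx_act_ofIdx, hmu]
    simp

/-- Distinct simple roots pair non-positively and weights in `Psi` pair to at least `-1`. Hence
either product is nonzero on `z_mu` only if `mu` pairs to `-1` with `α_i^∨`, to `1` with `α_j^∨`,
and the roots are orthogonal; then both products give `z_{mu + α_i - α_j}`. -/
theorem lie_e_f_of_ne [Finite ι] [P.IsCrystallographic] {i j : b.support} (hij : i ≠ j) :
    ⁅(e hPsi z i : Module.End ℚ V), f hPsi z j⁆ = 0 := by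
  have hle : P.pairing j i ≤ 0 := by
    have := b.pairingIn_le_zero_of_ne (fun h => hij (Subtype.ext h.symm)) j.2 i.2
    rw [← P.algebraMap_pairingIn ℤ]
    simpa using this
  have hle' : P.pairing i j ≤ 0 := by
    have := b.pairingIn_le_zero_of_ne (fun h => hij (Subtype.ext h)) i.2 j.2
    rw [← P.algebraMap_pairingIn ℤ]
    simpa using this
  have hzero : P.pairing i j = 0 ↔ P.pairing j i = 0 := P.pairing_eq_zero_iff'
  refine z.ext fun mu => ?_
  rw [Ring.lie_def, LinearMap.sub_apply, Module.End.mul_apply, Module.End.mul_apply,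
    LinearMap.zero_apply, sub_eq_zero]
  have hi := coroot'_ofIdx_smul (P := P) j i (mu : E)
  have hj := coroot'_ofIdx_smul (P := P) i j (mu : E)
  have hmu := hPsi.coroot'_apply i mu.2
  have hmu' := hPsi.coroot'_apply j mu.2
  by_cases hc : P.coroot' i mu = -1 ∧ P.coroot' j mu = 1 ∧ P.pairing j i = 0
  · obtain ⟨h1, h2, h3⟩ := hc
    have h4 := hzero.2 h3
    rw [h3, mul_zero, sub_zero, h1] at hi
    rw [h4, mul_zero, sub_zero, h2] at hj
    rw [f_apply hPsi z h2, e_apply hPsi z hi, e_apply hPsi z h1, f_apply hPsi z hj]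
    congr 1
    refine Subtype.ext ?_
    simp only [coe_act, ofIdx_smul_eq_sub] at hi hj ⊢
    rw [hi, hj, h1, h2]
    module
  · trans (0 : V)
    · by_cases h2 : P.coroot' j mu = 1
      · rw [f_apply hPsi z h2, e_apply_eq_zero]
        rw [coe_act, hi, h2]
        intro h5
        have h6 : P.coroot' i mu = -1 := by rcases hmu with h | h | h <;> linarith
        exact hc ⟨h6, h2, by linarith⟩
      · rw [f_apply_eq_zero hPsi z h2, map_zero]
    · by_cases h1 : P.coroot' i mu = -1
      · rw [e_apply hPsi z h1, f_apply_eq_zero]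
        rw [coe_act, hj, h1]
        intro h5
        have h6 : P.coroot' j mu = 1 := by rcases hmu' with h | h | h <;> linarith
        exact hc ⟨h1, h6, hzero.1 (by linarith)⟩
      · rw [e_apply_eq_zero hPsi z h1, map_zero]

theorem lie_e_f_lie_e (i j : b.support) :
    ⁅⁅(e hPsi z i : Module.End ℚ V), f hPsi z i⁆, (e hPsi z j : Module.End ℚ V)⁆ =
      P.pairing j i • (e hPsi z j : Module.End ℚ V) := by
  refine z.ext fun mu => ?_
  rw [Ring.lie_def, LinearMap.sub_apply, Module.End.mul_apply, Module.End.mul_apply,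
    lie_e_f_apply, LinearMap.smul_apply, map_smul]
  by_cases hmu : P.coroot' j mu = -1
  · rw [e_apply hPsi z hmu, lie_e_f_apply, coe_act, coroot'_ofIdx_smul, hmu]
    module
  · rw [e_apply_eq_zero hPsi z hmu]
    simp

theorem lie_e_f_lie_f (i j : b.support) :
    ⁅⁅(e hPsi z i : Module.End ℚ V), f hPsi z i⁆, (f hPsi z j : Module.End ℚ V)⁆ =
      (-P.pairing j i) • (f hPsi z j : Module.End ℚ V) := by
  refine z.ext fun mu => ?_
  rw [Ring.lie_def, LinearMap.sub_apply, Module.End.mul_apply, Module.End.mul_apply,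
    lie_e_f_apply, LinearMap.smul_apply, map_smul]
  by_cases hmu : P.coroot' j mu = 1
  · rw [f_apply hPsi z hmu, lie_e_f_apply, coe_act, coroot'_ofIdx_smul, hmu]
    module
  · rw [f_apply_eq_zero hPsi z hmu]
    simp

theorem chevalleyRelations [Finite ι] [P.IsCrystallographic] :
    ChevalleyRelations ℚ (L := Module.End ℚ V) (e hPsi z) (f hPsi z) where
  lie_of_ne _ _ hij := lie_e_f_of_ne hPsi z hij
  left i j := ⟨_, lie_e_f_lie_e hPsi z i j⟩
  right i j := ⟨_, lie_e_f_lie_f hPsi z i j⟩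

theorem oneAdd_conj_mem (T : Submodule ℚ (Module.End ℚ V)) (a : Module.End ℚ V) (ha : a * a = 0)
    (hT : ∀ A ∈ T, ⁅a, A⁆ ∈ T) {A : Module.End ℚ V} (hA : A ∈ T) :
    ((oneAdd a ha : LinearMap.GeneralLinearGroup ℚ V) : Module.End ℚ V) * A *
      ((oneAdd a ha)⁻¹ : LinearMap.GeneralLinearGroup ℚ V) ∈ T := by
  have h1 : ((oneAdd a ha : LinearMap.GeneralLinearGroup ℚ V) : Module.End ℚ V) * A *
      ((oneAdd a ha)⁻¹ : LinearMap.GeneralLinearGroup ℚ V) =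
        A + ⁅a, A⁆ + (1 / 2 : ℚ) • ⁅a, ⁅a, A⁆⁆ := by
    change (1 + a) * A * (1 - a) = _
    -- Conjugation by `1 + a` is the exponential of `ad a`; with `a² = 0` it stops at the quadratic
    -- term, whose factor `1/2` requires `ℚ`.
    have h2 : ⁅a, ⁅a, A⁆⁆ = (-2 : ℚ) • (a * A * a) := by
      have h3 : ⁅a, ⁅a, A⁆⁆ = a * a * A - (a * A * a + a * A * a) + A * (a * a) := by
        simp only [Ring.lie_def]
        noncomm_ring
      rw [h3, ha, zero_mul, mul_zero]
      module
    rw [h2, smul_smul, Ring.lie_def]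
    norm_num
    noncomm_ring
  rw [h1]
  exact add_mem (add_mem hA (hT A hA)) (Submodule.smul_mem _ _ (hT _ (hT A hA)))

theorem nWord_conj_mem [Finite ι] [P.IsCrystallographic] (l : List b.support)
    {A : Module.End ℚ V}
    (hA : A ∈ triangularSpan ℚ (L := Module.End ℚ V) (e hPsi z) (f hPsi z)) :
    (nWord hPsi z l : Module.End ℚ V) * A * ((nWord hPsi z l)⁻¹ : LinearMap.GeneralLinearGroup ℚ V) ∈
      triangularSpan ℚ (L := Module.End ℚ V) (e hPsi z) (f hPsi z) := by
  have hrel := chevalleyRelations hPsi z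
  set T := triangularSpan ℚ (L := Module.End ℚ V) (e hPsi z) (f hPsi z)
  have hx : ∀ (i : b.support) (t : ℚ) (A : Module.End ℚ V), A ∈ T →
      (x hPsi z i t : Module.End ℚ V) * A *
        ((x hPsi z i t)⁻¹ : LinearMap.GeneralLinearGroup ℚ V) ∈ T := fun i t A hA =>
    oneAdd_conj_mem T _ _ (fun B hB => by
      rw [smul_lie]; exact T.smul_mem _ (hrel.lie_left_mem i hB)) hA
  have hy : ∀ (i : b.support) (t : ℚ) (A : Module.End ℚ V), A ∈ T →
      (y hPsi z i t : Module.End ℚ V) * A *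
        ((y hPsi z i t)⁻¹ : LinearMap.GeneralLinearGroup ℚ V) ∈ T := fun i t A hA =>
    oneAdd_conj_mem T _ _ (fun B hB => by
      rw [smul_lie]; exact T.smul_mem _ (hrel.lie_right_mem i hB)) hA
  induction l with
  | nil => simpa using hA
  | cons i l ih =>
    have := hx i ((1 : ℚˣ) : ℚ) _ (hy i (-((1⁻¹ : ℚˣ) : ℚ)) _ (hx i ((1 : ℚˣ) : ℚ) _ ih))
    rw [nWord_cons, n]
    simpa only [mul_inv_rev, Units.val_mul, mul_assoc] using this

/-- The product is the coefficient, along `α_j` at the weight `w mu` with `w = weylWord l`, of the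
conjugate of `e_i` by the word; this conjugate lies in the triangular span, where such coefficients
are constant. -/
theorem wordSign_mul_wordSign [Finite ι] [P.IsRootSystem] [P.IsCrystallographic]
    {i j : b.support} {l : List b.support} (hl : weylWord l • (i : ι) = j) {mu nu : Psi}
    (hmu : P.coroot' i mu = -1) (hnu : P.coroot' i nu = -1) :
    wordSign hPsi l mu * wordSign hPsi l (act hPsi (ofIdx P i) mu) =
      wordSign hPsi l nu * wordSign hPsi l (act hPsi (ofIdx P i) nu) := by
  classical
  let z : Basis Psi ℚ (Psi →₀ ℚ) := Finsupp.basisSingleOne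
  set g := nWord hPsi z l
  set A : Module.End ℚ (Psi →₀ ℚ) := (g : Module.End ℚ (Psi →₀ ℚ)) * e hPsi z i *
    (g⁻¹ : LinearMap.GeneralLinearGroup ℚ (Psi →₀ ℚ)) with hA
  have hmem : A ∈ constantCoeff hPsi z j :=
    triangularSpan_le_constantCoeff hPsi z j (nWord_conj_mem hPsi z l
      (Submodule.subset_span (Or.inl (Or.inl (.base i)))))
  have key : ∀ mu : Psi, P.coroot' i mu = -1 →
      z.repr (A (z (act hPsi (weylWord l) mu)))
        (act hPsi (ofIdx P j) (act hPsi (weylWord l) mu)) =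
      (((wordSign hPsi l mu * wordSign hPsi l (act hPsi (ofIdx P i) mu) : ℤˣ) : ℤ) : ℚ) := by
    intro mu hmu
    have h1 : A ((g : Module.End ℚ (Psi →₀ ℚ)) (z mu)) =
        (g : Module.End ℚ (Psi →₀ ℚ)) (e hPsi z i (z mu)) := by
      rw [hA, ← Module.End.mul_apply, mul_assoc, Units.inv_mul, mul_one, Module.End.mul_apply]
    rw [e_apply hPsi z hmu, nWord_apply, nWord_apply, map_int_units_smul, ← act_mul, mul_ofIdx,
      hl, act_mul] at h1
    -- Signs are their own inverses, so this moves the sign of `mu` to the other side.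
    have h2 := congrArg (wordSign hPsi l mu • ·) h1
    simp only [← mul_smul, Int.units_mul_self, one_smul] at h2
    rw [h2, Units.smul_def, map_zsmul]
    simp
  have hj : ∀ mu : Psi, P.coroot' i mu = -1 → P.coroot' j (act hPsi (weylWord l) mu) = -1 :=
    fun mu hmu => by rw [coe_act, ← hl, coroot'_smul, hmu]
  have := hmem _ _ (hj mu hmu) (hj nu hnu)
  rw [key mu hmu, key nu hnu] at this
  exact Units.ext (by exact_mod_cast this)

end Signs

/-! ### The homomorphism from `N` to the Weyl group and its kernel -/

section Quotient

open RootPairing.weylGroup (ofIdx)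

variable {ι E E' : Type*} [AddCommGroup E] [Module ℚ E] [AddCommGroup E'] [Module ℚ E']
  {P : RootPairing ι ℚ E E'} {b : P.Base} {Psi : Set E}
  {R V : Type*} [CommRing R] [AddCommGroup V] [Module R V]
  (hPsi : IsMinusculeUnion b Psi) (z : Basis Psi R V)

theorem nCoeff_map_smul (q : ℚ) (c : ℤˣ) (v : V) :
    nCoeff q (Units.map (Int.castRingHom R : ℤ →* R) c) • v = nCoeff q c • v := by
  rcases Int.units_eq_one_or c with rfl | rfl <;> unfold nCoeff <;> split_ifs <;>
    simp [Units.smul_def]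

theorem exists_nWord_mul_n [Finite ι] [P.IsRootSystem] [P.IsCrystallographic]
    {i j : b.support} {l : List b.support} (hl : weylWord l • (i : ι) = j) :
    ∃ c : ℤˣ, nWord hPsi z l * n hPsi z i 1 =
      n hPsi z j (Units.map (Int.castRingHom R : ℤ →* R) c) * nWord hPsi z l := by
  obtain ⟨c, hc⟩ : ∃ c : ℤˣ, ∀ mu : Psi, P.coroot' i mu = -1 →
      wordSign hPsi l (act hPsi (ofIdx P i) mu) = wordSign hPsi l mu * c := by
    by_cases hex : ∃ nu : Psi, P.coroot' i nu = -1
    · obtain ⟨nu, hnu⟩ := hex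
      refine ⟨wordSign hPsi l nu * wordSign hPsi l (act hPsi (ofIdx P i) nu), fun mu hmu => ?_⟩
      rw [← wordSign_mul_wordSign hPsi hl hmu hnu, ← mul_assoc, Int.units_mul_self, one_mul]
    · exact ⟨1, fun mu hmu => absurd ⟨mu, hmu⟩ hex⟩
  refine ⟨c, generalLinearGroup_ext (z := z) fun mu => ?_⟩
  have hs : P.coroot' i (act hPsi (ofIdx P i) mu) = -P.coroot' i mu :=
    coroot'_ofIdx_smul_self (i : ι) (mu : E)
  have hj : P.coroot' j (act hPsi (weylWord l) mu) = P.coroot' i mu := by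
    rw [coe_act, ← hl, coroot'_smul]
  rw [Units.val_mul, Units.val_mul, Module.End.mul_apply, Module.End.mul_apply, n_apply,
    nCoeff_one_smul, map_int_units_smul, nWord_apply, nWord_apply, map_int_units_smul, n_apply,
    nCoeff_map_smul, hj, ← act_mul, mul_ofIdx, hl, act_mul, ← mul_smul, ← mul_smul]
  congr 1
  rcases hPsi.coroot'_apply i mu.2 with hmu | hmu | hmu
  · rw [act_ofIdx_of_eq_zero hPsi hmu, hmu]
    simp [nCoeff]
  -- The weight `s_i mu` pairs to `-1`, so the choice of `c` applies to it.
  · have := hc (act hPsi (ofIdx P i) mu) (by rw [hs, hmu])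
    rw [act_ofIdx_act_ofIdx] at this
    rw [this, hmu, nCoeff, nCoeff, if_pos rfl, if_pos rfl]
    simp [mul_assoc]
  · rw [hc mu hmu, hmu, nCoeff, nCoeff, if_neg (by norm_num), if_pos rfl, if_neg (by norm_num),
      if_pos rfl, one_mul]

/-- `n_i n_i(t) = (n_i h_i(t) n_i⁻¹) n_i²`, and `n_i² = h_i(-1)⁻¹`. -/
theorem n_mul_n_mem_H [P.IsCrystallographic] (i : b.support) (t : Rˣ) :
    n hPsi z i 1 * n hPsi z i t ∈ H hPsi z := by
  have h1 : n hPsi z i 1 * n hPsi z i 1 ∈ H hPsi z := by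
    have := inv_mem (h_mem_H hPsi z i (-1))
    rwa [h, n_neg, mul_inv_rev, inv_inv] at this
  convert mul_mem (n_conj_mem_H hPsi z i 1 (h_mem_H hPsi z i t)) h1 using 1
  rw [n_eq_h_mul_n_one hPsi z i t]
  group

theorem nWord_mem_H [Finite ι] [P.IsRootSystem] [P.IsCrystallographic] [P.IsReduced]
    (l : List b.support) (hl : weylWord l = 1) : nWord hPsi z l ∈ H hPsi z := by
  induction hN : l.length using Nat.strong_induction_on generalizing l with
  | _ N ih =>
    rcases List.eq_nil_or_concat' l with rfl | ⟨l', k, rfl⟩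
    · exact one_mem _
    · have hl' : weylWord l' = ofIdx P k := by
        rw [weylWord_append, weylWord_cons, weylWord_nil, mul_one] at hl
        rw [eq_inv_of_mul_eq_one_left hl, inv_eq_of_mul_eq_one_left (ofIdx_mul_self _)]
      -- `weylWord l' = s_k` sends `α_k` to `-α_k`.
      have hneg : ¬ b.IsPos (weylWord l' • (k : ι)) := by
        let := P.indexNeg
        rw [hl', ofIdx_smul_index]
        have := (RootPairing.Base.IsPos.neg_iff_not b (k : ι)).not.2
          (not_not.2 (b.isPos_of_mem_support k.2))
        exact this
      obtain ⟨l₁, j, l₂, rfl, hj⟩ := exists_weylWord_smul_eq_of_not_isPos l' k hneg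
      obtain ⟨c, hc⟩ := exists_nWord_mul_n hPsi z hj
      -- Deleting `j` and `k` shortens the word by two and keeps its image, since `w₂ s_k = s_j w₂`
      -- with `w₂ = weylWord l₂`.
      have hshort : nWord hPsi z (l₁ ++ l₂) ∈ H hPsi z := by
        refine ih _ ?_ (l₁ ++ l₂) ?_ rfl
        · rw [← hN]
          simp only [List.length_append, List.length_cons, List.length_nil]
          omega
        · rw [← hl]
          simp only [weylWord_append, weylWord_cons, weylWord_nil, mul_one, mul_assoc]
          rw [mul_ofIdx, hj, ← mul_assoc (ofIdx P (j : ι)), ofIdx_mul_self, one_mul]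
      have hconj := conj_mem_H hPsi z (nWord_mem_N hPsi z l₁)
        (n_mul_n_mem_H hPsi z j (Units.map (Int.castRingHom R : ℤ →* R) c))
      convert mul_mem hconj hshort using 1
      simp only [nWord_append, nWord_cons, nWord_nil, mul_one, mul_assoc]
      rw [hc]
      group

/-- `g` permutes the basis vectors, up to units, in the same way as `w` permutes the weights. -/
def ActsAs (g : LinearMap.GeneralLinearGroup R V) (w : P.weylGroup) : Prop :=
  ∀ mu, ∃ u : Rˣ, (g : V →ₗ[R] V) (z mu) = u • z (act hPsi w mu)

variable {hPsi z}

theorem ActsAs.one : ActsAs hPsi z 1 1 := fun mu => ⟨1, by simp⟩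

theorem ActsAs.mul {g g' : LinearMap.GeneralLinearGroup R V} {w w' : P.weylGroup}
    (hg : ActsAs hPsi z g w) (hg' : ActsAs hPsi z g' w') :
    ActsAs hPsi z (g * g') (w * w') := fun mu => by
  obtain ⟨u', hu'⟩ := hg' mu
  obtain ⟨u, hu⟩ := hg (act hPsi w' mu)
  exact ⟨u' * u, by
    rw [Units.val_mul, Module.End.mul_apply, hu', map_units_smul, hu, act_mul, mul_smul]⟩

theorem ActsAs.inv {g : LinearMap.GeneralLinearGroup R V} {w : P.weylGroup}
    (hg : ActsAs hPsi z g w) : ActsAs hPsi z g⁻¹ w⁻¹ := fun mu => by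
  obtain ⟨u, hu⟩ := hg (act hPsi w⁻¹ mu)
  refine ⟨u⁻¹, ?_⟩
  rw [act_inv_act] at hu
  rw [eq_inv_smul_iff, ← map_units_smul, ← hu, ← Module.End.mul_apply, Units.inv_mul,
    Module.End.one_apply]

/-- Units are nonzero in a nontrivial ring, so `g` determines the permutation of `Psi`, and the
action on `Psi` is faithful. -/
theorem ActsAs.unique [Nontrivial R] [P.IsIrreducible] {g : LinearMap.GeneralLinearGroup R V}
    {w w' : P.weylGroup} (hg : ActsAs hPsi z g w) (hg' : ActsAs hPsi z g w') : w = w' := by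
  refine act_injective hPsi (funext fun mu => ?_)
  obtain ⟨u, hu⟩ := hg mu
  obtain ⟨u', hu'⟩ := hg' mu
  by_contra hne
  have h1 := congrArg (fun v => z.repr v (act hPsi w mu)) (hu.symm.trans hu')
  simp only [Units.smul_def, map_smul, Basis.repr_self, Finsupp.smul_apply,
    Finsupp.single_eq_same, Finsupp.single_eq_of_ne hne, smul_eq_mul, mul_one, mul_zero] at h1
  exact u.ne_zero h1

variable (hPsi z)

theorem actsAs_n (i : b.support) (t : Rˣ) : ActsAs hPsi z (n hPsi z i t) (ofIdx P i) :=
  fun mu => ⟨_, n_apply hPsi z i t mu⟩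

theorem exists_actsAs {g : LinearMap.GeneralLinearGroup R V} (hg : g ∈ N hPsi z) :
    ∃ w, ActsAs hPsi z g w := by
  induction hg using Subgroup.closure_induction with
  | mem g hg =>
    obtain ⟨i, t, rfl⟩ := hg
    exact ⟨_, actsAs_n hPsi z i t⟩
  | one => exact ⟨1, .one⟩
  | mul g g' _ _ hg hg' =>
    obtain ⟨w, hw⟩ := hg
    obtain ⟨w', hw'⟩ := hg'
    exact ⟨_, hw.mul hw'⟩
  | inv g _ hg =>
    obtain ⟨w, hw⟩ := hg
    exact ⟨_, hw.inv⟩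

theorem actsAs_of_mem_H {g : LinearMap.GeneralLinearGroup R V} (hg : g ∈ H hPsi z) :
    ActsAs hPsi z g 1 := by
  induction hg using Subgroup.closure_induction with
  | mem g hg =>
    obtain ⟨i, t, rfl⟩ := hg
    intro mu
    obtain ⟨m, hm⟩ := exists_coroot'_eq_intCast hPsi i mu
    exact ⟨_, by rw [h_apply hPsi z i t mu hm, act_one]⟩
  | one => exact .one
  | mul g g' _ _ hg hg' => simpa using hg.mul hg'
  | inv g _ hg => simpa using hg.inv

theorem actsAs_nWord (l : List b.support) : ActsAs hPsi z (nWord hPsi z l) (weylWord l) := by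
  induction l with
  | nil => exact .one
  | cons i l ih => exact (actsAs_n hPsi z i 1).mul ih

/-- The homomorphism from `N` to the Weyl group given by the permutation of the weights. -/
def toWeylGroup [Nontrivial R] [P.IsIrreducible] : N hPsi z →* P.weylGroup :=
  MonoidHom.mk' (fun g => (exists_actsAs hPsi z g.2).choose) fun g g' =>
    (exists_actsAs hPsi z (g * g').2).choose_spec.unique
      ((exists_actsAs hPsi z g.2).choose_spec.mul (exists_actsAs hPsi z g'.2).choose_spec)

theorem toWeylGroup_eq [Nontrivial R] [P.IsIrreducible] {g : N hPsi z} {w : P.weylGroup}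
    (hg : ActsAs hPsi z g w) : toWeylGroup hPsi z g = w :=
  (exists_actsAs hPsi z g.2).choose_spec.unique hg

theorem toWeylGroup_n [Nontrivial R] [P.IsIrreducible] (i : b.support) :
    toWeylGroup hPsi z ⟨n hPsi z i 1, n_mem_N hPsi z i 1⟩ = ofIdx P i :=
  toWeylGroup_eq hPsi z (actsAs_n hPsi z i 1)

variable [Finite ι] [P.IsRootSystem] [P.IsCrystallographic] [P.IsReduced] [P.IsIrreducible]
  [Nontrivial R]

theorem toWeylGroup_surjective : Function.Surjective (toWeylGroup hPsi z) := by
  rw [← MonoidHom.range_eq_top, eq_top_iff, ← closure_ofIdx_support b, Subgroup.closure_le]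
  rintro _ ⟨i, rfl⟩
  exact ⟨_, toWeylGroup_n hPsi z i⟩

theorem ker_toWeylGroup : (toWeylGroup hPsi z).ker = (H hPsi z).subgroupOf (N hPsi z) := by
  ext ⟨g, hg⟩
  rw [MonoidHom.mem_ker, Subgroup.mem_subgroupOf]
  refine ⟨fun h1 => ?_, fun h1 => toWeylGroup_eq hPsi z (actsAs_of_mem_H hPsi z h1)⟩
  obtain ⟨k, hk, l, rfl⟩ := exists_eq_mul_nWord hPsi z hg
  refine mul_mem hk (nWord_mem_H hPsi z l ?_)
  rw [← h1]
  symm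
  refine toWeylGroup_eq hPsi z ?_
  simpa using (actsAs_of_mem_H hPsi z hk).mul (actsAs_nWord hPsi z l)

end Quotient

end MinusculeChevalley

end

/-! ### The isomorphism with the Weyl group -/

theorem lemma3p8 {ι E E' : Type*} [Finite ι]
    [AddCommGroup E] [Module ℚ E] [AddCommGroup E'] [Module ℚ E']
    (P : RootPairing ι ℚ E E') [P.IsRootSystem] [P.IsCrystallographic] [P.IsReduced]
    [P.IsIrreducible] (b : P.Base)
    (Psi : Set E) (hPsi : MinusculeChevalley.IsMinusculeUnion b Psi)
    {R : Type*} [CommRing R] [Nontrivial R] {V : Type*} [AddCommGroup V] [Module R V]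
    (z : Module.Basis Psi R V) :
    ∃ _normal : ((MinusculeChevalley.H hPsi z).subgroupOf (MinusculeChevalley.N hPsi z)).Normal,
      ∃! phi : P.weylGroup ≃*
          MinusculeChevalley.N hPsi z ⧸
            (MinusculeChevalley.H hPsi z).subgroupOf (MinusculeChevalley.N hPsi z),
        ∀ i : b.support,
          phi (RootPairing.weylGroup.ofIdx P i) =
            ((⟨MinusculeChevalley.n hPsi z i 1, MinusculeChevalley.n_mem_N hPsi z i 1⟩ :
                MinusculeChevalley.N hPsi z) :
              MinusculeChevalley.N hPsi z ⧸
                (MinusculeChevalley.H hPsi z).subgroupOf (MinusculeChevalley.N hPsi z)) := by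
  have hker := MinusculeChevalley.ker_toWeylGroup hPsi z
  have hnormal : ((MinusculeChevalley.H hPsi z).subgroupOf
      (MinusculeChevalley.N hPsi z)).Normal := hker ▸ inferInstance
  refine ⟨hnormal, ?_⟩
  let psi := (QuotientGroup.quotientMulEquivOfEq hker).symm.trans
    (QuotientGroup.quotientKerEquivOfSurjective _
      (MinusculeChevalley.toWeylGroup_surjective hPsi z))
  have hpsi : ∀ i : b.support, psi.symm (RootPairing.weylGroup.ofIdx P i) =
      ((⟨MinusculeChevalley.n hPsi z i 1, MinusculeChevalley.n_mem_N hPsi z i 1⟩ :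
        MinusculeChevalley.N hPsi z) : MinusculeChevalley.N hPsi z ⧸
          (MinusculeChevalley.H hPsi z).subgroupOf (MinusculeChevalley.N hPsi z)) := fun i => by
    rw [MulEquiv.symm_apply_eq, ← MinusculeChevalley.toWeylGroup_n hPsi z i]
    rfl
  refine ⟨psi.symm, hpsi, fun phi hphi => MulEquiv.toMonoidHom_injective ?_⟩
  -- Uniqueness: the simple reflections generate the Weyl group.
  refine MonoidHom.eq_of_eqOn_dense (MinusculeChevalley.closure_ofIdx_support b) ?_
  rintro _ ⟨i, rfl⟩
  exact (hphi i).trans (hpsi i).symm
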